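/- **Billingsley's theorem.** Definition of $\mathrm{PD}(1)$: let $U_1,U_2,\dots$ be independent random variables uniformly distributed on $(0,1)$, and put $G_1=1-U_1$, $G_2=U_1(1-U_2)$, $G_3=U_1U_2(1-U_3),\dots$. Let $Z_1\ge Z_2\ge\cdots$ be the outcome of sorting $G_1,G_2,\dots$ into decreasing order. The Poisson–Dirichlet distribution $\mathrm{PD}(1)$ is the law of the random sequence $(Z_1,Z_2,\dots)$ in $\mathbb R^{\mathbb N}$ (with the product topology). **Theorem.** For each integer $n>1$ let $N$ be a random integer chosen uniformly from $\{1,\dots,n\}$, and let $p_1\ge p_2\ge\cdots$ be the prime factors of $N$, listed with multiplicity. For $i\ge 1$ put $$L_i(n)=\frac{\log p_i}{\log n},$$ where $L_i(n)=0$ if $N=1$ or if $i$ exceeds the total number of prime factors of $N$, counted with multiplicity. Then, as $n\to\infty$, the random sequence $L(n)=(L_1(n),L_2(n),\dots)$ converges in distribution to $\mathrm{PD}(1)$. Equivalently, for each $k>0$ the $k$-tuple $(L_1(n),\dots,L_k(n))$ converges in distribution to the first $k$ coordinates of a $\mathrm{PD}(1)$ sequence. -/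

import Mathlib

open MeasureTheory ProbabilityTheory Filter

/-- The uniform distribution on the interval `(0, 1)`. -/
noncomputable def uniform01 : Measure ℝ :=
  volume.restrict (Set.Ioo 0 1)

instance uniform01_isProbabilityMeasure : IsProbabilityMeasure uniform01 :=
  ⟨by simp [uniform01]⟩

/-- The stick-breaking sequence built from `u = (u 0, u 1, …)`: with `V i = (u i) ^ (1 / θ)`, its
terms are `1 - V 0`, `V 0 * (1 - V 1)`, `V 0 * V 1 * (1 - V 2)`, …
For i.i.d. uniform `u i` this is the GEM process with parameter `θ > 0`. -/
noncomputable def gem (θ : ℝ) (u : ℕ → ℝ) (k : ℕ) : ℝ :=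
  (∏ j ∈ Finset.range k, u j ^ (1 / θ)) * (1 - u k ^ (1 / θ))

/-- The ranked version of a sequence `g` of nonnegative reals with finite sum: `ranked g k` is the
`(k + 1)`-st largest term of `g`, counted with multiplicity, that is, the largest value of the
minimum of `k + 1` terms of `g` with distinct indices. -/
noncomputable def ranked (g : ℕ → ℝ) (k : ℕ) : ℝ :=
  ⨆ s : {s : Finset ℕ // s.card = k + 1}, ⨅ i : s.1, g i

theorem measurable_gem (θ : ℝ) : Measurable (gem θ) := by
  refine measurable_pi_lambda _ fun k => ?_
  unfold gem
  fun_prop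

theorem measurable_ranked : Measurable ranked := by
  refine measurable_pi_lambda _ fun k => ?_
  unfold ranked
  exact Measurable.iSup fun s => Measurable.iInf fun i => measurable_pi_apply _

/-- The Poisson-Dirichlet distribution with parameter `θ > 0`, as a law on sequences: the law of
the ranked GEM sequence built from independent uniform random variables on `(0, 1)`. -/
noncomputable def poissonDirichlet (θ : ℝ) : Measure (ℕ → ℝ) :=
  (Measure.infinitePi fun _ : ℕ => uniform01).map fun u => ranked (gem θ u)

instance poissonDirichlet_isProbabilityMeasure (θ : ℝ) :
    IsProbabilityMeasure (poissonDirichlet θ) :=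
  Measure.isProbabilityMeasure_map (measurable_ranked.comp (measurable_gem θ)).aemeasurable

/-- The scaled log prime factors of `N`: if `p 0 ≥ p 1 ≥ …` are the prime factors of `N`, with
multiplicity, then the term with index `i` is `log (p i) / log n`, and it is `0` when `i` is at
least the number of prime factors (in particular for all `i` when `N = 1`). -/
noncomputable def logPrimeFactors (n N : ℕ) (i : ℕ) : ℝ :=
  if h : i < N.primeFactorsList.reverse.length then
    Real.log (N.primeFactorsList.reverse[i] : ℝ) / Real.log n
  else 0

/-! The proof orders the prime factors of a random integer by size-biased picks. Given `m ≤ x`, pick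
a prime `p ∣ m` with weight `log p / log x`, then continue with `m / p ≤ x / p`. The total weight is
at most 1, because the logarithms of the distinct primes dividing `m` add up to at most `log m`.
Averaged over `m ≤ x`, the first pick is `p` with weight about `log p / (p log x)`, so by Mertens'
first theorem the ratio `log (x / p) / log x` is asymptotically uniform on [0, 1]. Repeating this,
the successive ratios are asymptotically independent uniforms (`eventually_mul_le_sum_pickWeight`).

The ratios turn the factorization into stick-breaking: the GEM sequence built from them is exactly
`log pᵢ / log x`. Ranking forgets the order of the picks, so it returns the scaled logarithms of the
sorted factors (`logPrimeFactors_eq_ranked_gem`).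

Only lower bounds are needed. By the portmanteau theorem it suffices to bound liminf of the
probability of each open set `G` from below. The preimage of `G` under ranked stick-breaking is
exhausted, up to measure, by finite unions of cubical cells, and each cell receives asymptotically
at least its volume. Weight lost to repeated primes or to `m < x` is harmless. -/

/-! ### Mertens' first theorem, from the prime factorization of `n!`. -/

theorem log_factorial_eq_sum_primesLE (n : ℕ) :
    Real.log (n.factorial : ℝ) =
      ∑ p ∈ n.primesLE, (n.factorial.factorization p : ℝ) * Real.log p := by
  rw [Real.log_nat_eq_sum_factorization, Finsupp.sum]
  refine Finset.sum_subset (fun p hp => ?_) (fun p _ hp => ?_)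
  · have h := Nat.prime_of_mem_primeFactors (by simpa using hp)
    have hd := Nat.dvd_of_mem_primeFactors (by simpa using hp)
    exact Nat.mem_primesLE.2 ⟨(h.dvd_factorial).1 hd, h⟩
  · simp [Finsupp.notMem_support_iff.1 hp]

theorem div_sub_one_le_factorization_factorial {p : ℕ} (hp : p.Prime) (n : ℕ) :
    (n : ℝ) / p - 1 ≤ (n.factorial.factorization p : ℝ) := by
  have h2 : n / p ≤ n.factorial.factorization p := by
    -- The `+ 2` keeps the exponent 1 inside the range of Legendre's sum even when `n < p`.
    rw [Nat.factorization_factorial hp (b := Nat.log p n + 2) (by omega)]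
    calc n / p = n / p ^ 1 := by simp
      _ ≤ _ := Finset.single_le_sum (f := fun i => n / p ^ i) (fun _ _ => Nat.zero_le _)
          (by simp)
  have h3 : ((n / p : ℕ) : ℝ) ≤ n.factorial.factorization p := by exact_mod_cast h2
  have h4 : (n : ℝ) / p < ((n / p : ℕ) : ℝ) + 1 := by
    rw [← Nat.floor_div_eq_div (K := ℝ)]
    exact Nat.lt_floor_add_one _
  linarith

theorem factorization_factorial_le_div {p : ℕ} (hp : p.Prime) (n : ℕ) :
    (n.factorial.factorization p : ℝ) ≤ (n : ℝ) / (p - 1) := by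
  have := Fact.mk hp
  have h := sub_one_mul_padicValNat_factorial (p := p) n
  have h1 : (p - 1) * n.factorial.factorization p ≤ n := by
    rw [Nat.factorization_def _ hp, h]; omega
  have h2 : (1 : ℝ) < p := by exact_mod_cast hp.one_lt
  rw [le_div_iff₀ (by linarith), mul_comm]
  have h3 : (((p - 1) * n.factorial.factorization p : ℕ) : ℝ) ≤ n := by exact_mod_cast h1
  rwa [Nat.cast_mul, Nat.cast_sub hp.one_le, Nat.cast_one] at h3

/-- Compare `n! ≤ n ^ n` with the multiplicity bound `n / p - 1`; the loss from the `- 1` is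
Chebyshev's θ(n), at most `n log 4`. -/
theorem sum_primesLE_log_div_le {n : ℕ} (hn : n ≠ 0) :
    ∑ p ∈ n.primesLE, Real.log p / p ≤ Real.log n + Real.log 4 := by
  have hn0 : (0 : ℝ) < n := by positivity
  have h1 : ∑ p ∈ n.primesLE, ((n : ℝ) / p - 1) * Real.log p ≤ Real.log (n.factorial : ℝ) := by
    rw [log_factorial_eq_sum_primesLE]
    refine Finset.sum_le_sum fun p hp => ?_
    exact mul_le_mul_of_nonneg_right
      (div_sub_one_le_factorization_factorial (Nat.mem_primesLE.1 hp).2 n)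
      (Real.log_natCast_nonneg p)
  have h2 : Real.log (n.factorial : ℝ) ≤ n * Real.log n := by
    rw [← Real.log_pow]
    exact Real.log_le_log (by positivity) (by exact_mod_cast Nat.factorial_le_pow n)
  have h3 : ∑ p ∈ n.primesLE, ((n : ℝ) / p - 1) * Real.log p =
      n * (∑ p ∈ n.primesLE, Real.log p / p) - ∑ p ∈ n.primesLE, Real.log p := by
    rw [Finset.mul_sum, ← Finset.sum_sub_distrib]
    exact Finset.sum_congr rfl fun p _ => by ring
  have h4 := Chebyshev.theta_le_log4_mul_x (x := n) hn0.le
  rw [Chebyshev.theta_eq_sum_primesLE_log] at h4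
  have : n * (∑ p ∈ n.primesLE, Real.log p / p) ≤ n * (Real.log n + Real.log 4) := by
    linarith
  exact le_of_mul_le_mul_left this hn0

/-- This is the cost of replacing `1 / (p - 1)` by `1 / p`. Since `log p ≤ 2 √p`, the terms are
dominated by `4 p ^ (-3/2)`. -/
theorem exists_sum_primesLE_log_div_mul_sub_one_le :
    ∃ C : ℝ, ∀ n : ℕ, ∑ p ∈ n.primesLE, Real.log p / (p * (p - 1)) ≤ C := by
  have hs : Summable fun m : ℕ => 4 * (1 / (m : ℝ) ^ (3 / 2 : ℝ)) :=
    (Real.summable_one_div_nat_rpow.2 (by norm_num)).mul_left 4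
  refine ⟨∑' m : ℕ, 4 * (1 / (m : ℝ) ^ (3 / 2 : ℝ)), fun n => ?_⟩
  refine (Finset.sum_le_sum fun p hp => ?_).trans
    (hs.sum_le_tsum n.primesLE fun _ _ => by positivity)
  have hp2 : (2 : ℝ) ≤ p := by exact_mod_cast (Nat.mem_primesLE.1 hp).2.two_le
  have hl : Real.log p ≤ 2 * (p : ℝ) ^ (1 / 2 : ℝ) := by
    have := Real.log_le_rpow_div (x := p) (by linarith) (ε := 1 / 2) (by norm_num)
    linarith
  have hr : (p : ℝ) ^ (3 / 2 : ℝ) * (p : ℝ) ^ (1 / 2 : ℝ) = p * p := by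
    rw [← Real.rpow_add (by linarith)]
    norm_num
    ring
  have hr0 : 0 < (p : ℝ) ^ (3 / 2 : ℝ) := by positivity
  rw [mul_one_div, div_le_div_iff₀ (by nlinarith) hr0]
  calc Real.log p * (p : ℝ) ^ (3 / 2 : ℝ)
      ≤ 2 * (p : ℝ) ^ (1 / 2 : ℝ) * (p : ℝ) ^ (3 / 2 : ℝ) := by gcongr
    _ = 2 * (p * p) := by rw [← hr]; ring
    _ ≤ 4 * (p * (p - 1)) := by nlinarith

/-- **Mertens' first theorem** at natural numbers. -/
theorem exists_abs_sum_primesLE_log_div_sub_log_le :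
    ∃ C : ℝ, ∀ n : ℕ, n ≠ 0 →
      |∑ p ∈ n.primesLE, Real.log p / p - Real.log n| ≤ C := by
  obtain ⟨C, hC⟩ := exists_sum_primesLE_log_div_mul_sub_one_le
  refine ⟨max (Real.log 4) (1 + C), fun n hn => abs_le.2 ⟨?_, ?_⟩⟩
  · have hn0 : (0 : ℝ) < n := by positivity
    have h1 : Real.log (n.factorial : ℝ) ≤ ∑ p ∈ n.primesLE, (n : ℝ) / (p - 1) * Real.log p := by
      rw [log_factorial_eq_sum_primesLE]
      refine Finset.sum_le_sum fun p hp => ?_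
      exact mul_le_mul_of_nonneg_right
        (factorization_factorial_le_div (Nat.mem_primesLE.1 hp).2 n) (Real.log_natCast_nonneg p)
    have h2 : n * Real.log n - n ≤ Real.log (n.factorial : ℝ) := by
      have := Stirling.le_log_factorial_stirling hn
      have h5 := Real.log_natCast_nonneg n
      have h6 : 0 ≤ Real.log (2 * Real.pi) := Real.log_nonneg (by linarith [Real.pi_gt_three])
      linarith
    have h3 : ∑ p ∈ n.primesLE, (n : ℝ) / (p - 1) * Real.log p =
        n * (∑ p ∈ n.primesLE, Real.log p / p +
          ∑ p ∈ n.primesLE, Real.log p / (p * (p - 1))) := by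
      rw [← Finset.sum_add_distrib, Finset.mul_sum]
      refine Finset.sum_congr rfl fun p hp => ?_
      have : (1 : ℝ) < p := by exact_mod_cast (Nat.mem_primesLE.1 hp).2.one_lt
      have h7 : (p : ℝ) - 1 ≠ 0 := by linarith
      have h8 : (p : ℝ) ≠ 0 := by linarith
      field_simp
      ring
    have h4 : n * (Real.log n - 1) ≤ n * (∑ p ∈ n.primesLE, Real.log p / p +
          ∑ p ∈ n.primesLE, Real.log p / (p * (p - 1))) := by linarith
    have h5 := le_of_mul_le_mul_left h4 hn0
    have := hC n
    have := le_max_right (Real.log 4) (1 + C)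
    linarith
  · have := sum_primesLE_log_div_le hn
    have := le_max_left (Real.log 4) (1 + C)
    linarith

/-- **Mertens' first theorem** at real numbers. -/
theorem exists_abs_sum_primesLE_floor_log_div_sub_log_le :
    ∃ C : ℝ, ∀ x : ℝ, 1 ≤ x →
      |∑ p ∈ ⌊x⌋₊.primesLE, Real.log p / p - Real.log x| ≤ C := by
  obtain ⟨C, hC⟩ := exists_abs_sum_primesLE_log_div_sub_log_le
  refine ⟨C + Real.log 2, fun x hx => ?_⟩
  have hf : 1 ≤ ⌊x⌋₊ := (Nat.one_le_floor_iff x).2 hx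
  have hf' : (1 : ℝ) ≤ ⌊x⌋₊ := by exact_mod_cast hf
  have h1 := abs_le.1 (hC ⌊x⌋₊ (by omega))
  have h2 : Real.log ⌊x⌋₊ ≤ Real.log x :=
    Real.log_le_log (by linarith) (Nat.floor_le (by linarith))
  have h3 : Real.log x ≤ Real.log 2 + Real.log ⌊x⌋₊ := by
    rw [← Real.log_mul (by norm_num) (by linarith)]
    refine Real.log_le_log (by linarith) ?_
    linarith [Nat.lt_floor_add_one x]
  have h4 : 0 ≤ Real.log 2 := Real.log_nonneg (by norm_num)
  exact abs_le.2 ⟨by linarith, by linarith⟩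

/-! ### Size-biased picks of prime factors and their average weight. -/

/-- The primes `p ≤ x` for which `log (x / p) / log x` lies in `[a, b)`. -/
noncomputable def primesWithRatio (x a b : ℝ) : Finset ℕ :=
  {p ∈ ⌊x⌋₊.primesLE | Real.log (x / p) / Real.log x ∈ Set.Ico a b}

theorem mem_primesWithRatio {x a b : ℝ} {p : ℕ} (hx : 0 ≤ x) :
    p ∈ primesWithRatio x a b ↔
      p.Prime ∧ (p : ℝ) ≤ x ∧ Real.log (x / p) / Real.log x ∈ Set.Ico a b := by
  rw [primesWithRatio, Finset.mem_filter, Nat.mem_primesLE, Nat.le_floor_iff hx]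
  tauto

/-- The window contains the primes in `(x ^ (1 - b), x ^ (1 - a)]`, so the bound is a difference of
two Mertens estimates. -/
theorem exists_mul_log_le_sum_primesWithRatio :
    ∃ C : ℝ, ∀ x a b : ℝ, 1 < x → 0 ≤ a → a ≤ b → b ≤ 1 →
      (b - a) * Real.log x - C ≤ ∑ p ∈ primesWithRatio x a b, Real.log p / p := by
  obtain ⟨C, hC⟩ := exists_abs_sum_primesLE_floor_log_div_sub_log_le
  refine ⟨2 * C, fun x a b hx ha hab hb => ?_⟩
  have hx0 : 0 < x := by linarith
  have hlx : 0 < Real.log x := Real.log_pos hx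
  have hsub : ⌊x ^ (1 - a)⌋₊.primesLE \ ⌊x ^ (1 - b)⌋₊.primesLE ⊆ primesWithRatio x a b := by
    intro p hp
    rw [Finset.mem_sdiff, Nat.mem_primesLE, Nat.mem_primesLE,
      Nat.le_floor_iff (by positivity), Nat.le_floor_iff (by positivity)] at hp
    obtain ⟨⟨h1, hpp⟩, h2⟩ := hp
    have h2 : x ^ (1 - b) < p := by
      by_contra h
      exact h2 ⟨not_lt.1 h, hpp⟩
    have hp0 : (0 : ℝ) < p := by exact_mod_cast hpp.pos
    have h3 := Real.log_le_log hp0 h1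
    have h4 := Real.log_lt_log (by positivity) h2
    rw [Real.log_rpow hx0] at h3 h4
    rw [mem_primesWithRatio hx0.le]
    refine ⟨hpp, h1.trans ?_, ?_⟩
    · calc x ^ (1 - a) ≤ x ^ (1 : ℝ) := Real.rpow_le_rpow_of_exponent_le hx.le (by linarith)
        _ = x := Real.rpow_one x
    · rw [Real.log_div hx0.ne' hp0.ne', Set.mem_Ico, le_div_iff₀ hlx, div_lt_iff₀ hlx]
      constructor <;> linarith
  have hss : ⌊x ^ (1 - b)⌋₊.primesLE ⊆ ⌊x ^ (1 - a)⌋₊.primesLE := by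
    intro p hp
    rw [Nat.mem_primesLE] at hp ⊢
    refine ⟨hp.1.trans (Nat.floor_mono ?_), hp.2⟩
    exact Real.rpow_le_rpow_of_exponent_le hx.le (by linarith)
  have h5 := Finset.sum_sdiff (f := fun p : ℕ => Real.log p / p) hss
  have h6 := Finset.sum_le_sum_of_subset_of_nonneg hsub
    (f := fun p : ℕ => Real.log p / p) fun p _ _ => by positivity
  have h7 := abs_le.1 (hC (x ^ (1 - a)) (Real.one_le_rpow hx.le (by linarith)))
  have h8 := abs_le.1 (hC (x ^ (1 - b)) (Real.one_le_rpow hx.le (by linarith)))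
  rw [Real.log_rpow hx0] at h7 h8
  linarith

/-- The weight given to `m` by successive size-biased picks of prime factors: it sums, over the
sequences `p₀, p₁, …` with `p₀ ⋯ pᵢ ∣ m` whose ratios
`log (x / (p₀ ⋯ pᵢ)) / log (x / (p₀ ⋯ pᵢ₋₁))` lie in the cells `[J i / M, (J i + 1) / M)`,
the products of the `log pᵢ / log (x / (p₀ ⋯ pᵢ₋₁))`. -/
noncomputable def pickWeight (M : ℕ) : (k : ℕ) → ℝ → ℕ → (Fin k → Fin M) → ℝ
  | 0, _, _, _ => 1
  | k + 1, x, m, J =>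
    ∑ p ∈ m.primeFactors with
        Real.log (x / (p : ℕ)) / Real.log x ∈ Set.Ico ((J 0 : ℝ) / M) (((J 0 : ℝ) + 1) / M),
      Real.log p / Real.log x * pickWeight M k (x / p) (m / p) (Fin.tail J)

theorem one_le_div_of_dvd {x : ℝ} {m p : ℕ} (hm : m ≠ 0) (hmx : (m : ℝ) ≤ x) (hp : p ∣ m) :
    1 ≤ m / p ∧ ((m / p : ℕ) : ℝ) ≤ x / p := by
  have hp0 : 0 < p := Nat.pos_of_dvd_of_pos hp (Nat.pos_of_ne_zero hm)
  refine ⟨Nat.div_pos (Nat.le_of_dvd (Nat.pos_of_ne_zero hm) hp) hp0, ?_⟩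
  rw [Nat.cast_div hp (by positivity)]
  gcongr

theorem pickWeight_nonneg {M k : ℕ} {x : ℝ} {m : ℕ} (hm : m ≠ 0) (hmx : (m : ℝ) ≤ x)
    (J : Fin k → Fin M) : 0 ≤ pickWeight M k x m J := by
  induction k generalizing x m with
  | zero => exact zero_le_one
  | succ k ih =>
    refine Finset.sum_nonneg fun p hp => ?_
    have hp := (Finset.mem_filter.1 hp).1
    have h := one_le_div_of_dvd hm hmx (Nat.dvd_of_mem_primeFactors hp)
    have h1 : (1 : ℝ) ≤ m := by exact_mod_cast Nat.one_le_iff_ne_zero.2 hm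
    exact mul_nonneg (div_nonneg (Real.log_natCast_nonneg p) (Real.log_nonneg (by linarith)))
      (ih (by omega) h.2 _)

theorem sum_primeFactors_log_le {m : ℕ} (hm : m ≠ 0) :
    ∑ p ∈ m.primeFactors, Real.log p ≤ Real.log m := by
  rw [Real.log_nat_eq_sum_factorization, Finsupp.sum, Nat.support_factorization]
  refine Finset.sum_le_sum fun p hp => ?_
  have h1 : 1 ≤ m.factorization p :=
    (Nat.prime_of_mem_primeFactors hp).factorization_pos_of_dvd hm
      (Nat.dvd_of_mem_primeFactors hp)
  have h2 : (1 : ℝ) ≤ m.factorization p := by exact_mod_cast h1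
  nlinarith [Real.log_natCast_nonneg p]

theorem eq_of_mem_Ico_div {M : ℕ} {y : ℝ} {i j : Fin M}
    (hi : y ∈ Set.Ico ((i : ℝ) / M) (((i : ℝ) + 1) / M))
    (hj : y ∈ Set.Ico ((j : ℝ) / M) (((j : ℝ) + 1) / M)) : i = j := by
  have hM : (0 : ℝ) < M := by exact_mod_cast i.pos
  rw [Set.mem_Ico, div_le_iff₀ hM, lt_div_iff₀ hM] at hi hj
  have h1 : ((i : ℕ) : ℝ) < ((j : ℕ) : ℝ) + 1 := by linarith
  have h2 : ((j : ℕ) : ℝ) < ((i : ℕ) : ℝ) + 1 := by linarith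
  norm_cast at h1 h2
  omega

/-- The cells are disjoint, so each `p` is counted at most once per pick, and the pick weights total
at most `log m / log x ≤ 1`. -/
theorem sum_pickWeight_le_one {M k : ℕ} {x : ℝ} {m : ℕ} (hm : m ≠ 0) (hmx : (m : ℝ) ≤ x) :
    ∑ J : Fin k → Fin M, pickWeight M k x m J ≤ 1 := by
  induction k generalizing x m with
  | zero => simp [pickWeight]
  | succ k ih =>
    have h1 : (1 : ℝ) ≤ m := by exact_mod_cast Nat.one_le_iff_ne_zero.2 hm
    have hlx : 0 ≤ Real.log x := Real.log_nonneg (by linarith)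
    rw [← (Fin.consEquiv fun _ : Fin (k + 1) => Fin M).sum_comp, Fintype.sum_prod_type]
    simp only [Fin.consEquiv_apply, pickWeight, Fin.cons_zero]
    calc ∑ j : Fin M, ∑ J : Fin k → Fin M, ∑ p ∈ m.primeFactors with
            Real.log (x / (p : ℕ)) / Real.log x ∈ Set.Ico ((j : ℝ) / M) (((j : ℝ) + 1) / M),
          Real.log p / Real.log x * pickWeight M k (x / p) (m / p) J
        ≤ ∑ j : Fin M, ∑ p ∈ m.primeFactors with
            Real.log (x / (p : ℕ)) / Real.log x ∈ Set.Ico ((j : ℝ) / M) (((j : ℝ) + 1) / M),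
          Real.log p / Real.log x := by
          refine Finset.sum_le_sum fun j _ => ?_
          rw [Finset.sum_comm]
          refine Finset.sum_le_sum fun p hp => ?_
          have hp := (Finset.mem_filter.1 hp).1
          have h := one_le_div_of_dvd hm hmx (Nat.dvd_of_mem_primeFactors hp)
          rw [← Finset.mul_sum]
          exact mul_le_of_le_one_right (div_nonneg (Real.log_natCast_nonneg p) hlx)
            (ih (by omega) h.2)
      _ ≤ ∑ p ∈ m.primeFactors, Real.log p / Real.log x := by
          simp only [Finset.sum_filter]
          rw [Finset.sum_comm]
          refine Finset.sum_le_sum fun p _ => ?_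
          have hnn : 0 ≤ Real.log p / Real.log x := div_nonneg (Real.log_natCast_nonneg p) hlx
          by_cases hex : ∃ j : Fin M,
              Real.log (x / p) / Real.log x ∈ Set.Ico ((j : ℝ) / M) (((j : ℝ) + 1) / M)
          · obtain ⟨j, hj⟩ := hex
            rw [Finset.sum_eq_single j (fun i _ hij => if_neg fun hi =>
              hij (eq_of_mem_Ico_div hi hj)) (by simp), if_pos hj]
          · rw [Finset.sum_eq_zero fun j _ => if_neg fun hj => hex ⟨j, hj⟩]
            exact hnn
      _ ≤ 1 := by
          rw [← Finset.sum_div]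
          exact div_le_one_of_le₀ ((sum_primeFactors_log_le hm).trans
            (Real.log_le_log (by linarith) hmx)) hlx

/-- Exchange the order of summation through `(m, p) ↦ (p, m / p)`. -/
theorem sum_pickWeight_succ {M k : ℕ} {x : ℝ} (hx : 0 ≤ x) (J : Fin (k + 1) → Fin M) :
    ∑ m ∈ Finset.Icc 1 ⌊x⌋₊, pickWeight M (k + 1) x m J =
      ∑ p ∈ primesWithRatio x ((J 0 : ℝ) / M) (((J 0 : ℝ) + 1) / M),
        Real.log p / Real.log x *
          ∑ m ∈ Finset.Icc 1 ⌊x / p⌋₊, pickWeight M k (x / p) m (Fin.tail J) := by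
  simp only [pickWeight, Finset.mul_sum]
  rw [Finset.sum_sigma', Finset.sum_sigma']
  refine Finset.sum_bij' (fun a _ => ⟨a.2, a.1 / a.2⟩) (fun b _ => ⟨b.1 * b.2, b.1⟩)
    ?_ ?_ ?_ ?_ ?_
  · rintro ⟨m, p⟩ h
    simp only [Finset.mem_sigma, Finset.mem_Icc, Finset.mem_filter, Nat.mem_primeFactors,
      mem_primesWithRatio hx, Nat.le_floor_iff hx] at h ⊢
    obtain ⟨⟨h1, h2⟩, ⟨hp, hd, h0⟩, hI⟩ := h
    have h3 := one_le_div_of_dvd h0 h2 hd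
    have h4 : (p : ℝ) ≤ m := by exact_mod_cast Nat.le_of_dvd (by omega) hd
    refine ⟨⟨hp, h4.trans h2, hI⟩, h3.1, ?_⟩
    rw [Nat.le_floor_iff (by positivity)]
    exact h3.2
  · rintro ⟨p, m⟩ h
    simp only [Finset.mem_sigma, Finset.mem_Icc, Finset.mem_filter, Nat.mem_primeFactors,
      mem_primesWithRatio hx, Nat.le_floor_iff hx] at h ⊢
    obtain ⟨⟨hp, hpx, hI⟩, h1, h2⟩ := h
    rw [Nat.le_floor_iff (by positivity)] at h2
    have hp0 : (0 : ℝ) < p := by exact_mod_cast hp.pos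
    rw [le_div_iff₀ hp0] at h2
    refine ⟨⟨Nat.mul_pos hp.pos h1, ?_⟩, ⟨hp, Dvd.intro _ rfl, ?_⟩, hI⟩
    · push_cast; linarith
    · exact (Nat.mul_pos hp.pos h1).ne'
  · rintro ⟨m, p⟩ h
    simp only [Finset.mem_sigma, Finset.mem_filter, Nat.mem_primeFactors] at h
    simp [Nat.mul_div_cancel' h.2.1.2.1]
  · rintro ⟨p, m⟩ h
    simp only [Finset.mem_sigma, mem_primesWithRatio hx] at h
    simp [Nat.mul_div_cancel_left m h.1.1.pos]
  · rintro ⟨m, p⟩ h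
    rfl

/-- Split off the first pick: by induction the inner sum is at least about `M ^ (-k) * x / p`, and
by Mertens `log p / p` sums to about `log x / M` over a window of width `1 / M`, which cancels the
division by `log x`. -/
theorem eventually_mul_le_sum_pickWeight {M k : ℕ} (J : Fin k → Fin M) {c : ℝ}
    (hc : c < (1 / (M : ℝ)) ^ k) :
    ∀ᶠ x : ℝ in atTop, c * x ≤ ∑ m ∈ Finset.Icc 1 ⌊x⌋₊, pickWeight M k x m J := by
  induction k generalizing c with
  | zero =>
    simp only [pow_zero] at hc
    filter_upwards [eventually_ge_atTop (1 / (1 - c)), eventually_ge_atTop 0] with x hx hx0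
    have h1 : 0 < 1 - c := by linarith
    rw [div_le_iff₀ h1] at hx
    simp only [pickWeight, Finset.sum_const, Nat.card_Icc, nsmul_eq_mul, mul_one,
      Nat.add_sub_cancel]
    linarith [Nat.lt_floor_add_one x]
  | succ k ih =>
    obtain ⟨C, hC⟩ := exists_mul_log_le_sum_primesWithRatio
    have hM : (0 : ℝ) < M := by exact_mod_cast (J 0).pos
    -- Raising the left end of the cell by `δ` forces `x / p ≥ x ^ δ`, so the induction hypothesis
    -- applies uniformly in `p`; `c1` lies just below `M ^ (-k)`. Both come from one small `t`.
    obtain ⟨c1, δ, hc10, hc1, hδ0, hδ, hcc⟩ : ∃ c1 δ : ℝ, 0 ≤ c1 ∧ c1 < (1 / (M : ℝ)) ^ k ∧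
        0 < δ ∧ δ < 1 / M ∧ c < c1 * (1 / M - δ) := by
      have hP : 0 < (1 / (M : ℝ)) ^ k := by positivity
      have ht : Tendsto (fun t : ℝ => (1 / (M : ℝ)) ^ k * (1 - t) * (1 / M - t)) (nhdsWithin 0 (Set.Ioi 0))
          (nhds ((1 / (M : ℝ)) ^ k * (1 - 0) * (1 / M - 0))) :=
        Tendsto.mono_left (Continuous.tendsto (by fun_prop) 0) nhdsWithin_le_nhds
      have h1 := ht.eventually_const_lt (u := c) (by rw [pow_succ] at hc; simpa using hc)
      have h2 : ∀ᶠ t : ℝ in nhdsWithin 0 (Set.Ioi 0), t < min 1 (1 / (M : ℝ)) :=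
        nhdsWithin_le_nhds (Iio_mem_nhds (by positivity))
      obtain ⟨t, h1, h2, h3⟩ := (h1.and (h2.and self_mem_nhdsWithin)).exists
      have h3 : 0 < t := h3
      have h4 := lt_min_iff.1 h2
      refine ⟨(1 / (M : ℝ)) ^ k * (1 - t), t, ?_, ?_, h3, h4.2, h1⟩
      · exact mul_nonneg hP.le (by linarith)
      · nlinarith
    obtain ⟨X, hX⟩ := eventually_atTop.1 (ih (Fin.tail J) hc1)
    have hgrow : ∀ᶠ x : ℝ in atTop, X ≤ x ^ δ :=
      (tendsto_rpow_atTop hδ0).eventually_ge_atTop X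
    -- Beyond this threshold the Mertens error `c1 * C` is absorbed by the slack in `c < c1 * (1 / M
    -- - δ)`.
    have hlog : ∀ᶠ x : ℝ in atTop, c1 * C / (c1 * (1 / M - δ) - c) ≤ Real.log x :=
      Real.tendsto_log_atTop.eventually_ge_atTop _
    filter_upwards [hgrow, hlog, eventually_gt_atTop 1] with x hxX hxl hx1
    have hx0 : 0 < x := by linarith
    have hlx : 0 < Real.log x := Real.log_pos hx1
    have ha0 : 0 ≤ (J 0 : ℝ) / M := by positivity
    have hb1 : ((J 0 : ℝ) + 1) / M ≤ 1 := by
      rw [div_le_one hM]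
      exact_mod_cast (J 0).2
    have hab : ((J 0 : ℝ) + 1) / M = (J 0 : ℝ) / M + 1 / M := add_div _ _ _
    rw [sum_pickWeight_succ hx0.le]
    have hsub : primesWithRatio x ((J 0 : ℝ) / M + δ) (((J 0 : ℝ) + 1) / M) ⊆
        primesWithRatio x ((J 0 : ℝ) / M) (((J 0 : ℝ) + 1) / M) := by
      intro p hp
      rw [mem_primesWithRatio hx0.le] at hp ⊢
      exact ⟨hp.1, hp.2.1, by linarith [hp.2.2.1], hp.2.2.2⟩
    have hnn : ∀ p ∈ primesWithRatio x ((J 0 : ℝ) / M) (((J 0 : ℝ) + 1) / M),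
        0 ≤ Real.log p / Real.log x *
          ∑ m ∈ Finset.Icc 1 ⌊x / p⌋₊, pickWeight M k (x / p) m (Fin.tail J) := by
      intro p _
      refine mul_nonneg (div_nonneg (Real.log_natCast_nonneg p) hlx.le)
        (Finset.sum_nonneg fun m hm => ?_)
      rw [Finset.mem_Icc, Nat.le_floor_iff (by positivity)] at hm
      exact pickWeight_nonneg (by omega) hm.2 _
    refine le_trans ?_ (Finset.sum_le_sum_of_subset_of_nonneg hsub fun p hp _ => hnn p hp)
    have hstep : ∀ p ∈ primesWithRatio x ((J 0 : ℝ) / M + δ) (((J 0 : ℝ) + 1) / M),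
        c1 * x / Real.log x * (Real.log p / p) ≤ Real.log p / Real.log x *
          ∑ m ∈ Finset.Icc 1 ⌊x / p⌋₊, pickWeight M k (x / p) m (Fin.tail J) := by
      intro p hp
      rw [mem_primesWithRatio hx0.le] at hp
      obtain ⟨hpp, hpx, h1, h2⟩ := hp
      have hp0 : (0 : ℝ) < p := by exact_mod_cast hpp.pos
      have h3 : x ^ δ ≤ x / p := by
        rw [← Real.log_le_log_iff (by positivity) (by positivity), Real.log_rpow hx0]
        rw [le_div_iff₀ hlx] at h1
        nlinarith
      have h4 := hX _ (hxX.trans h3)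
      calc c1 * x / Real.log x * (Real.log p / p)
          = Real.log p / Real.log x * (c1 * (x / p)) := by ring
        _ ≤ _ := mul_le_mul_of_nonneg_left h4
            (div_nonneg (Real.log_natCast_nonneg p) hlx.le)
    refine le_trans ?_ (Finset.sum_le_sum hstep)
    rw [← Finset.mul_sum]
    have h5 := hC x ((J 0 : ℝ) / M + δ) (((J 0 : ℝ) + 1) / M) hx1 (by linarith)
      (by linarith) hb1
    rw [show ((J 0 : ℝ) + 1) / M - ((J 0 : ℝ) / M + δ) = 1 / M - δ by rw [hab]; ring] at h5
    rw [div_le_iff₀ (by linarith)] at hxl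
    calc c * x = x / Real.log x * (c * Real.log x) := by field_simp
      _ ≤ x / Real.log x * (c1 * ((1 / M - δ) * Real.log x - C)) := by
          refine mul_le_mul_of_nonneg_left ?_ (by positivity)
          linarith
      _ = c1 * x / Real.log x * ((1 / M - δ) * Real.log x - C) := by ring
      _ ≤ _ := mul_le_mul_of_nonneg_left h5 (by positivity)

/-! ### Prime factorizations as stick-breaking. -/

theorem gem_one_zero (v : ℕ → ℝ) : gem 1 v 0 = 1 - v 0 := by simp [gem]

theorem gem_one_succ (v : ℕ → ℝ) (i : ℕ) :
    gem 1 v (i + 1) = v 0 * gem 1 (fun j => v (j + 1)) i := by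
  simp only [gem, div_one, Real.rpow_one, Finset.prod_range_succ']
  ring

theorem gem_one_apply (v : ℕ → ℝ) (i : ℕ) :
    gem 1 v i = (∏ j ∈ Finset.range i, v j) * (1 - v i) := by
  simp [gem]

/-- The ratios `log (x / (p₀ ⋯ pᵢ)) / log (x / (p₀ ⋯ pᵢ₋₁))` for a list `p₀, p₁, …`, continued by
`1` after the end of the list. -/
noncomputable def logRatios : ℝ → List ℕ → ℕ → ℝ
  | _, [], _ => 1
  | x, p :: _, 0 => Real.log (x / p) / Real.log x
  | x, p :: l, i + 1 => logRatios (x / p) l i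

/-- The product of the ratios telescopes. After the end of the list the ratio 1 breaks off a piece
of length 0, matching `log 1 = 0` for the default factor 1. -/
theorem gem_logRatios {x : ℝ} {l : List ℕ} (hl : ∀ p ∈ l, Nat.Prime p)
    (hx : (l.prod : ℝ) ≤ x) (i : ℕ) :
    gem 1 (logRatios x l) i = Real.log (l.getD i 1 : ℕ) / Real.log x := by
  induction l generalizing x i with
  | nil => simp [gem_one_apply, logRatios]
  | cons p l ih =>
    have hp : p.Prime := hl p (by simp)
    have hl' : ∀ q ∈ l, Nat.Prime q := fun q hq => hl q (by simp [hq])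
    have hl0 : 1 ≤ l.prod := Nat.one_le_iff_ne_zero.2
      (List.prod_ne_zero fun h => Nat.not_prime_zero (hl' 0 h))
    have hl1 : (1 : ℝ) ≤ l.prod := by exact_mod_cast hl0
    have hp2 : (2 : ℝ) ≤ p := by exact_mod_cast hp.two_le
    have hx' : (p : ℝ) * l.prod ≤ x := by simpa using hx
    have hx1 : 1 < x := by nlinarith
    have hlx : Real.log x ≠ 0 := (Real.log_pos hx1).ne'
    have hxp : (l.prod : ℝ) ≤ x / p := by
      rw [le_div_iff₀ (by linarith)]
      linarith
    cases i with
    | zero =>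
      rw [gem_one_zero, logRatios, Real.log_div (by linarith) (by linarith)]
      simp only [List.getD_cons_zero]
      field_simp
      ring
    | succ i =>
      rw [gem_one_succ]
      simp only [logRatios, List.getD_cons_succ]
      rw [show (fun j => logRatios (x / p) l j) = logRatios (x / p) l from rfl, ih hl' hxp]
      -- If `x / p = 1` the next ratios would divide by zero, but then no prime is left in the list.
      by_cases h0 : Real.log (x / p) = 0
      · have h1 : x / p = 1 := by
          have := Real.eq_one_of_pos_of_log_eq_zero (x := x / p) (by linarith) h0
          exact this
        have h2 : l = [] := by
          cases l with
          | nil => rfl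
          | cons q t =>
            exfalso
            have hq : q.Prime := hl' q (by simp)
            have h3 : q ≤ (q :: t).prod := by
              rw [List.prod_cons]
              exact Nat.le_mul_of_pos_right _ (Nat.pos_of_ne_zero (List.prod_ne_zero fun h =>
                Nat.not_prime_zero (hl' 0 (by simp [h]))))
            have h4 : ((2 : ℕ) : ℝ) ≤ ((q :: t).prod : ℕ) := by
              exact_mod_cast hq.two_le.trans h3
            rw [h1] at hxp
            norm_num at h4 hxp
            linarith
        simp [h2]
      · field_simp

theorem logRatios_mem_Icc {x : ℝ} {l : List ℕ} (hl : ∀ p ∈ l, Nat.Prime p)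
    (hx : (l.prod : ℝ) ≤ x) (i : ℕ) : logRatios x l i ∈ Set.Icc (0 : ℝ) 1 := by
  induction l generalizing x i with
  | nil => simp [logRatios]
  | cons p l ih =>
    have hp : p.Prime := hl p (by simp)
    have hl' : ∀ q ∈ l, Nat.Prime q := fun q hq => hl q (by simp [hq])
    have hl0 : 1 ≤ l.prod := Nat.one_le_iff_ne_zero.2
      (List.prod_ne_zero fun h => Nat.not_prime_zero (hl' 0 h))
    have hl1 : (1 : ℝ) ≤ l.prod := by exact_mod_cast hl0
    have hp2 : (2 : ℝ) ≤ p := by exact_mod_cast hp.two_le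
    have hx' : (p : ℝ) * l.prod ≤ x := by simpa using hx
    have hx1 : 1 < x := by nlinarith
    have hlx := Real.log_pos hx1
    have hxp : (l.prod : ℝ) ≤ x / p := by
      rw [le_div_iff₀ (by linarith)]
      linarith
    cases i with
    | zero =>
      simp only [logRatios]
      refine ⟨div_nonneg (Real.log_nonneg (by linarith)) hlx.le, ?_⟩
      rw [div_le_one hlx]
      exact Real.log_le_log (by linarith) (div_le_self (by linarith) (by linarith))
    | succ i => exact ih hl' hxp i

/-- A nonzero summand supplies a first pick `p`, and recursively an ordering of the factors of `m /
p` to put after it. -/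
theorem exists_perm_of_pickWeight_ne_zero {M k : ℕ} {x : ℝ} {m : ℕ} (hm : m ≠ 0)
    {J : Fin k → Fin M} (hw : pickWeight M k x m J ≠ 0) :
    ∃ l : List ℕ, l.Perm m.primeFactorsList ∧
      ∀ i : Fin k, logRatios x l i ∈ Set.Ico ((J i : ℝ) / M) (((J i : ℝ) + 1) / M) := by
  induction k generalizing x m with
  | zero => exact ⟨_, List.Perm.refl _, fun i => i.elim0⟩
  | succ k ih =>
    obtain ⟨p, hp, hpw⟩ := Finset.exists_ne_zero_of_sum_ne_zero hw
    obtain ⟨hpm, hI⟩ := Finset.mem_filter.1 hp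
    have hd := Nat.dvd_of_mem_primeFactors hpm
    have hpp := Nat.prime_of_mem_primeFactors hpm
    have h0 : m / p ≠ 0 :=
      (Nat.div_pos (Nat.le_of_dvd (Nat.pos_of_ne_zero hm) hd) hpp.pos).ne'
    obtain ⟨l, hl, hli⟩ := ih h0 (right_ne_zero_of_mul hpw)
    refine ⟨p :: l, ?_, Fin.cases ?_ fun i => ?_⟩
    · refine Nat.primeFactorsList_unique ?_ ?_
      · rw [List.prod_cons, hl.prod_eq, Nat.prod_primeFactorsList h0, Nat.mul_div_cancel' hd]
      · intro q hq
        rcases List.mem_cons.1 hq with rfl | hq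
        · exact hpp
        · exact Nat.prime_of_mem_primeFactorsList (hl.mem_iff.1 hq)
    · exact hI
    · exact hli i

/-! ### Ranking: invariance under permutation and stability. -/

theorem ranked_comp_perm (g : ℕ → ℝ) (σ : Equiv.Perm ℕ) : ranked (fun i => g (σ i)) = ranked g := by
  funext k
  let e : {s : Finset ℕ // s.card = k + 1} ≃ {s : Finset ℕ // s.card = k + 1} :=
    (Equiv.finsetCongr σ).subtypeEquiv fun s => by simp
  unfold ranked
  refine e.iSup_congr fun s => ?_
  let e' : s.1 ≃ (e s).1 := σ.subtypeEquiv fun a => by simp [e]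
  exact (Equiv.iInf_congr (g := fun i : (e s).1 => g i) e' fun i => rfl).symm

theorem ranked_of_antitone {g : ℕ → ℝ} (hg : Antitone g) : ranked g = g := by
  funext k
  have : Nonempty {s : Finset ℕ // s.card = k + 1} := ⟨⟨Finset.range (k + 1), by simp⟩⟩
  have hle : ∀ s : {s : Finset ℕ // s.card = k + 1}, ⨅ i : s.1, g i ≤ g k := by
    rintro ⟨s, hs⟩
    obtain ⟨i, his, hik⟩ : ∃ i ∈ s, k ≤ i := by
      by_contra! h
      have := Finset.card_le_card (fun i hi => Finset.mem_range.2 (h i hi) : s ⊆ Finset.range k)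
      rw [Finset.card_range] at this
      omega
    exact (ciInf_le (Set.finite_range _).bddBelow (⟨i, his⟩ : s)).trans (hg hik)
  refine le_antisymm (ciSup_le hle) ?_
  refine le_trans ?_ (le_ciSup ⟨g k, Set.forall_mem_range.2 hle⟩
    ⟨Finset.range (k + 1), by simp⟩)
  have : Nonempty (Finset.range (k + 1)) := ⟨⟨0, by simp⟩⟩
  exact le_ciInf fun i => hg (by have := Finset.mem_range.1 i.2; omega)

/-- Ranking is monotone and commutes with adding constants. Boundedness keeps the real supremum from
taking its default value. -/
theorem ranked_le_add {g h : ℕ → ℝ} {ε : ℝ} (hb : BddAbove (Set.range h))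
    (hgh : ∀ i, g i ≤ h i + ε) (k : ℕ) : ranked g k ≤ ranked h k + ε := by
  have : Nonempty {s : Finset ℕ // s.card = k + 1} := ⟨⟨Finset.range (k + 1), by simp⟩⟩
  obtain ⟨B, hB⟩ := hb
  refine ciSup_le fun s => ?_
  have hne : Nonempty s.1 := by
    obtain ⟨a, ha⟩ := Finset.card_pos.1 (by rw [s.2]; omega : 0 < s.1.card)
    exact ⟨⟨a, ha⟩⟩
  have hbdd : BddAbove (Set.range fun s : {s : Finset ℕ // s.card = k + 1} => ⨅ i : s.1, h i) := by
    refine ⟨B, Set.forall_mem_range.2 fun s => ?_⟩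
    obtain ⟨a, ha⟩ := Finset.card_pos.1 (by rw [s.2]; omega : 0 < s.1.card)
    exact (ciInf_le (Set.finite_range _).bddBelow (⟨a, ha⟩ : s.1)).trans
      (hB (Set.mem_range_self _))
  have h1 : ⨅ i : s.1, g i ≤ (⨅ i : s.1, h i) + ε := by
    rw [← sub_le_iff_le_add]
    refine le_ciInf fun i => ?_
    rw [sub_le_iff_le_add]
    exact (ciInf_le (Set.finite_range _).bddBelow i).trans (hgh i)
  exact h1.trans (by gcongr; exact le_ciSup hbdd s)

theorem abs_ranked_sub_le {g h : ℕ → ℝ} {ε : ℝ} (hg : BddAbove (Set.range g))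
    (hh : BddAbove (Set.range h)) (hgh : ∀ i, |g i - h i| ≤ ε) (k : ℕ) :
    |ranked g k - ranked h k| ≤ ε := by
  have h1 := ranked_le_add hh (fun i => by linarith [(abs_le.1 (hgh i)).2]) k (g := g) (ε := ε)
  have h2 := ranked_le_add hg (fun i => by linarith [(abs_le.1 (hgh i)).1]) k (g := h) (ε := ε)
  exact abs_le.2 ⟨by linarith, by linarith⟩

theorem exists_perm_getD_of_perm {α : Type*} {l l' : List α} (h : l.Perm l') (d : α) :
    ∃ σ : Equiv.Perm ℕ, ∀ i, l.getD (σ i) d = l'.getD i d := by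
  induction h with
  | nil => exact ⟨1, fun i => rfl⟩
  | cons a _ ih =>
    obtain ⟨σ, hσ⟩ := ih
    -- Fix 0 and let `σ` act on the shifted indices.
    refine ⟨⟨fun i => i.casesOn 0 fun j => σ j + 1, fun i => i.casesOn 0 fun j => σ.symm j + 1,
      fun i => ?_, fun i => ?_⟩, fun i => ?_⟩
    · cases i <;> simp
    · cases i <;> simp
    · cases i
      · rfl
      · simpa using hσ _
  | swap a b l =>
    refine ⟨Equiv.swap 0 1, fun i => ?_⟩
    match i with
    | 0 => simp
    | 1 => simp
    | i + 2 => rw [Equiv.swap_apply_of_ne_of_ne (by omega) (by omega)]; simp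
  | trans _ _ ih₁ ih₂ =>
    obtain ⟨σ, hσ⟩ := ih₁
    obtain ⟨τ, hτ⟩ := ih₂
    exact ⟨τ.trans σ, fun i => (hσ _).trans (hτ i)⟩

/-! ### The sorted prime factors as a ranked stick-breaking sequence. -/

theorem logPrimeFactors_eq_getD (n N i : ℕ) :
    logPrimeFactors n N i =
      Real.log (N.primeFactorsList.reverse.getD i 1 : ℕ) / Real.log n := by
  unfold logPrimeFactors
  split_ifs with h
  · rw [List.getD_eq_getElem _ _ h]
  · rw [List.getD_eq_default _ _ (not_lt.1 h)]
    simp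

theorem logPrimeFactors_antitone (n N : ℕ) : Antitone (logPrimeFactors n N) := by
  intro i j hij
  rw [logPrimeFactors_eq_getD, logPrimeFactors_eq_getD]
  have hpos : ∀ k, 0 < N.primeFactorsList.reverse.getD k 1 := by
    intro k
    rcases lt_or_ge k N.primeFactorsList.reverse.length with h | h
    · rw [List.getD_eq_getElem _ _ h]
      exact (Nat.prime_of_mem_primeFactorsList
        (List.mem_reverse.1 (List.getElem_mem h))).pos
    · rw [List.getD_eq_default _ _ h]
      exact one_pos
  refine div_le_div_of_nonneg_right ?_ (Real.log_natCast_nonneg n)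
  refine Real.log_le_log (by exact_mod_cast hpos j) ?_
  norm_cast
  rcases lt_or_ge j N.primeFactorsList.reverse.length with h | h
  · rw [List.getD_eq_getElem _ _ h, List.getD_eq_getElem _ _ (hij.trans_lt h)]
    simp only [List.getElem_reverse]
    exact (Nat.primeFactorsList_sorted N).getElem_le_getElem_of_le (by omega)
  · rw [List.getD_eq_default _ _ h]
    exact hpos i

theorem logPrimeFactors_eq_ranked_gem {n m : ℕ} (hm : m ≠ 0) (hmn : m ≤ n) {l : List ℕ}
    (hl : l.Perm m.primeFactorsList) :
    logPrimeFactors n m = ranked (gem 1 (logRatios n l)) := by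
  obtain ⟨σ, hσ⟩ := exists_perm_getD_of_perm (hl.trans (List.reverse_perm _).symm) 1
  rw [← ranked_comp_perm _ σ, ← ranked_of_antitone (logPrimeFactors_antitone n m)]
  congr 1
  funext i
  have hprime : ∀ p ∈ l, Nat.Prime p := fun p hp =>
    Nat.prime_of_mem_primeFactorsList (hl.mem_iff.1 hp)
  have hprod : l.prod = m := by rw [hl.prod_eq, Nat.prod_primeFactorsList hm]
  rw [gem_logRatios hprime (by rw [hprod]; exact_mod_cast hmn), hσ, logPrimeFactors_eq_getD]

/-! ### Almost sure properties of independent uniforms. -/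

theorem uniform01_Ico_le (a b : ℝ) : uniform01 (Set.Ico a b) ≤ ENNReal.ofReal (b - a) := by
  rw [← Real.volume_Ico]
  exact Measure.restrict_apply_le _ _

theorem uniform01_Ioi_half : uniform01 (Set.Ioi (1 / 2)) = ENNReal.ofReal (1 / 2) := by
  rw [uniform01, Measure.restrict_apply measurableSet_Ioi]
  have : Set.Ioi (1 / 2 : ℝ) ∩ Set.Ioo 0 1 = Set.Ioo (1 / 2) 1 := by
    ext x
    simp only [Set.mem_inter_iff, Set.mem_Ioi, Set.mem_Ioo]
    constructor
    · rintro ⟨h1, h2, h3⟩; exact ⟨h1, h3⟩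
    · rintro ⟨h1, h2⟩; exact ⟨h1, by linarith, h2⟩
  rw [this, Real.volume_Ioo]
  norm_num

theorem ae_forall_mem_Ioo :
    ∀ᵐ u ∂(Measure.infinitePi fun _ : ℕ => uniform01), ∀ i, u i ∈ Set.Ioo (0 : ℝ) 1 := by
  refine ae_all_iff.2 fun i => ?_
  have h : ∀ᵐ x ∂uniform01, x ∈ Set.Ioo (0 : ℝ) 1 := ae_restrict_mem measurableSet_Ioo
  exact (measurePreserving_eval_infinitePi (fun _ : ℕ => uniform01) i).quasiMeasurePreserving.ae h

/-- That `l` consecutive terms all exceed 1/2 has probability `2 ^ (-l)`. -/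
theorem ae_frequently_le_half :
    ∀ᵐ u ∂(Measure.infinitePi fun _ : ℕ => uniform01), ∀ m : ℕ, ∃ j, m ≤ j ∧ u j ≤ 1 / 2 := by
  refine ae_all_iff.2 fun m => ?_
  rw [ae_iff]
  have hle : ∀ l : ℕ, (Measure.infinitePi fun _ : ℕ => uniform01)
      {u | ¬∃ j, m ≤ j ∧ u j ≤ 1 / 2} ≤ ENNReal.ofReal (1 / 2) ^ l := by
    intro l
    calc (Measure.infinitePi fun _ : ℕ => uniform01) {u | ¬∃ j, m ≤ j ∧ u j ≤ 1 / 2}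
        ≤ (Measure.infinitePi fun _ : ℕ => uniform01)
          (Set.pi (Finset.Ico m (m + l)) fun _ => Set.Ioi (1 / 2)) := by
          refine measure_mono fun u hu i hi => ?_
          have hi := Finset.mem_Ico.1 (Finset.mem_coe.1 hi)
          exact not_le.1 fun h => hu ⟨i, hi.1, h⟩
      _ = ENNReal.ofReal (1 / 2) ^ l := by
          rw [Measure.infinitePi_pi _ fun _ _ => measurableSet_Ioi]
          simp only [uniform01_Ioi_half, Finset.prod_const, Nat.card_Ico,
            Nat.add_sub_cancel_left]
  refine le_antisymm (ge_of_tendsto' (ENNReal.tendsto_pow_atTop_nhds_zero_of_lt_one ?_) hle)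
    zero_le
  rw [ENNReal.ofReal_lt_one]
  norm_num

theorem tendsto_prod_range_zero {u : ℕ → ℝ} (hu : ∀ i, u i ∈ Set.Ioo (0 : ℝ) 1)
    (hf : ∀ m : ℕ, ∃ j, m ≤ j ∧ u j ≤ 1 / 2) :
    Tendsto (fun k => ∏ j ∈ Finset.range k, u j) atTop (nhds 0) := by
  have hnn : ∀ k, 0 ≤ ∏ j ∈ Finset.range k, u j := fun k =>
    Finset.prod_nonneg fun j _ => (hu j).1.le
  have hanti : Antitone fun k => ∏ j ∈ Finset.range k, u j := by
    refine antitone_nat_of_succ_le fun k => ?_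
    rw [Finset.prod_range_succ]
    exact mul_le_of_le_one_right (hnn k) (hu k).2.le
  have hlim := tendsto_atTop_ciInf hanti ⟨0, Set.forall_mem_range.2 hnn⟩
  set L := ⨅ k, ∏ j ∈ Finset.range k, u j with hL
  have hle : ∀ k, L ≤ ∏ j ∈ Finset.range k, u j := fun k =>
    ciInf_le ⟨0, Set.forall_mem_range.2 hnn⟩ k
  have hL0 : 0 ≤ L := le_ciInf hnn
  have hL1 : L ≤ 0 := by
    by_contra! hpos
    -- Once the product is below `2 * L`, a factor at most 1/2 takes it below its infimum `L`.
    obtain ⟨m, hm⟩ := (hlim.eventually_lt_const (by linarith : L < 2 * L)).exists_forall_of_atTop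
    obtain ⟨j, hmj, hj⟩ := hf m
    have h1 := hm j hmj
    have h2 := hle (j + 1)
    rw [Finset.prod_range_succ] at h2
    nlinarith [hnn j]
  rwa [le_antisymm hL1 hL0] at hlim

/-! ### Continuity of ranked stick-breaking. -/

theorem gem_one_mem_Icc {v : ℕ → ℝ} (hv : ∀ i, v i ∈ Set.Icc (0 : ℝ) 1) (i : ℕ) :
    gem 1 v i ∈ Set.Icc 0 (∏ j ∈ Finset.range i, v j) := by
  rw [gem_one_apply]
  have h0 : 0 ≤ ∏ j ∈ Finset.range i, v j := Finset.prod_nonneg fun j _ => (hv j).1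
  have := hv i
  exact ⟨mul_nonneg h0 (by linarith [this.2]), mul_le_of_le_one_right h0 (by linarith [this.1])⟩

theorem prod_range_antitone {v : ℕ → ℝ} (hv : ∀ i, v i ∈ Set.Icc (0 : ℝ) 1) :
    Antitone fun k => ∏ j ∈ Finset.range k, v j := by
  refine antitone_nat_of_succ_le fun k => ?_
  rw [Finset.prod_range_succ]
  exact mul_le_of_le_one_right (Finset.prod_nonneg fun j _ => (hv j).1) (hv k).2

theorem bddAbove_range_gem_one {v : ℕ → ℝ} (hv : ∀ i, v i ∈ Set.Icc (0 : ℝ) 1) :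
    BddAbove (Set.range (gem 1 v)) := by
  refine ⟨1, Set.forall_mem_range.2 fun i => (gem_one_mem_Icc hv i).2.trans ?_⟩
  simpa using prod_range_antitone hv (Nat.zero_le i)

/-- Every piece from index `k` on is at most the stick remaining after `k` breaks, which is small
near `u` too; the first `k` pieces are continuous. So the GEM sequences are uniformly close, and
ranking preserves this. -/
theorem continuousWithinAt_ranked_gem_one {u : ℕ → ℝ} (hu : ∀ i, u i ∈ Set.Icc (0 : ℝ) 1)
    (h0 : Tendsto (fun k => ∏ j ∈ Finset.range k, u j) atTop (nhds 0)) :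
    ContinuousWithinAt (fun v => ranked (gem 1 v)) {v | ∀ i, v i ∈ Set.Icc (0 : ℝ) 1} u := by
  refine tendsto_pi_nhds.2 fun r => Metric.tendsto_nhds.2 fun ε hε => ?_
  obtain ⟨k, hk⟩ := (h0.eventually_lt_const (half_pos hε)).exists
  have hc1 : ∀ᶠ v in nhdsWithin u {v | ∀ i, v i ∈ Set.Icc (0 : ℝ) 1},
      ∏ j ∈ Finset.range k, v j < ε / 2 := by
    have : Continuous fun v : ℕ → ℝ => ∏ j ∈ Finset.range k, v j := by fun_prop
    exact nhdsWithin_le_nhds ((this.tendsto u).eventually_lt_const hk)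
  have hc2 : ∀ᶠ v in nhdsWithin u {v | ∀ i, v i ∈ Set.Icc (0 : ℝ) 1},
      ∀ i ∈ Finset.range k, |gem 1 v i - gem 1 u i| < ε / 2 := by
    rw [eventually_all_finset]
    intro i _
    have : Continuous fun v : ℕ → ℝ => gem 1 v i := by
      simp only [gem_one_apply]
      fun_prop
    have h := Metric.tendsto_nhds.1 (this.tendsto u) (ε / 2) (half_pos hε)
    exact nhdsWithin_le_nhds h
  filter_upwards [hc1, hc2, self_mem_nhdsWithin] with v hv1 hv2 hv
  rw [Real.dist_eq]
  refine lt_of_le_of_lt (abs_ranked_sub_le (bddAbove_range_gem_one hv)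
    (bddAbove_range_gem_one hu) (ε := ε / 2) (fun i => ?_) r) (half_lt_self hε)
  rcases lt_or_ge i k with hi | hi
  · exact (hv2 i (Finset.mem_range.2 hi)).le
  · have h1 := gem_one_mem_Icc hv i
    have h2 := gem_one_mem_Icc hu i
    have h3 : ∏ j ∈ Finset.range i, v j ≤ ∏ j ∈ Finset.range k, v j := prod_range_antitone hv hi
    have h4 : ∏ j ∈ Finset.range i, u j ≤ ∏ j ∈ Finset.range k, u j := prod_range_antitone hu hi
    exact abs_le.2 ⟨by linarith [h1.1, h2.2], by linarith [h1.2, h2.1]⟩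

/-! ### Approximation of open sets by cells from inside. -/

open Classical in
/-- The cells of side `1 / M` of `[0, 1]^M` over which the ranked stick-breaking sequence
certainly lies in `G`. -/
noncomputable def innerCells (G : Set (ℕ → ℝ)) (M : ℕ) : Finset (Fin M → Fin M) :=
  {J | ∀ v : ℕ → ℝ, (∀ i, v i ∈ Set.Icc (0 : ℝ) 1) →
    (∀ i : Fin M, v i ∈ Set.Ico ((J i : ℝ) / M) (((J i : ℝ) + 1) / M)) → ranked (gem 1 v) ∈ G}

theorem mem_innerCells {G : Set (ℕ → ℝ)} {M : ℕ} {J : Fin M → Fin M} :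
    J ∈ innerCells G M ↔ ∀ v : ℕ → ℝ, (∀ i, v i ∈ Set.Icc (0 : ℝ) 1) →
      (∀ i : Fin M, v i ∈ Set.Ico ((J i : ℝ) / M) (((J i : ℝ) + 1) / M)) →
        ranked (gem 1 v) ∈ G := by
  simp [innerCells]

/-- The sequences whose first `M` terms lie in one of the inner cells of `G`. -/
def innerSet (G : Set (ℕ → ℝ)) (M : ℕ) : Set (ℕ → ℝ) :=
  ⋃ J ∈ innerCells G M, {u | ∀ i : Fin M, u i ∈ Set.Ico ((J i : ℝ) / M) (((J i : ℝ) + 1) / M)}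

theorem infinitePi_innerSet_le (G : Set (ℕ → ℝ)) (M : ℕ) :
    (Measure.infinitePi fun _ : ℕ => uniform01) (innerSet G M) ≤
      ENNReal.ofReal ((innerCells G M).card * (1 / (M : ℝ)) ^ M) := by
  have hcell : ∀ J ∈ innerCells G M, (Measure.infinitePi fun _ : ℕ => uniform01)
      {u | ∀ i : Fin M, u i ∈ Set.Ico ((J i : ℝ) / M) (((J i : ℝ) + 1) / M)} ≤
        ENNReal.ofReal (1 / (M : ℝ)) ^ M := by
    intro J _
    let t : ℕ → Set ℝ := fun i => if h : i < M then
      Set.Ico ((J ⟨i, h⟩ : ℝ) / M) (((J ⟨i, h⟩ : ℝ) + 1) / M) else Set.univ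
    have hset : {u : ℕ → ℝ | ∀ i : Fin M, u i ∈ Set.Ico ((J i : ℝ) / M) (((J i : ℝ) + 1) / M)} =
        Set.pi (Finset.range M) t := by
      ext u
      simp only [Set.mem_ofPred_eq, Set.mem_pi, Finset.coe_range, Set.mem_Iio, t]
      constructor
      · intro h i hi
        simpa [hi] using h ⟨i, hi⟩
      · intro h i
        simpa [i.2] using h i i.2
    have ht : ∀ i ∈ Finset.range M, MeasurableSet (t i) := by
      intro i hi
      simp only [t, dif_pos (Finset.mem_range.1 hi)]
      exact measurableSet_Ico
    rw [hset, Measure.infinitePi_pi _ ht]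
    calc ∏ i ∈ Finset.range M, uniform01 (t i)
        ≤ ∏ i ∈ Finset.range M, ENNReal.ofReal (1 / (M : ℝ)) := by
          refine Finset.prod_le_prod' fun i hi => ?_
          simp only [t, dif_pos (Finset.mem_range.1 hi)]
          refine (uniform01_Ico_le _ _).trans (le_of_eq ?_)
          congr 1
          ring
      _ = _ := by simp
  calc (Measure.infinitePi fun _ : ℕ => uniform01) (innerSet G M)
      ≤ ∑ J ∈ innerCells G M, (Measure.infinitePi fun _ : ℕ => uniform01)
        {u | ∀ i : Fin M, u i ∈ Set.Ico ((J i : ℝ) / M) (((J i : ℝ) + 1) / M)} :=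
        measure_biUnion_finset_le _ _
    _ ≤ ∑ J ∈ innerCells G M, ENNReal.ofReal (1 / (M : ℝ)) ^ M := Finset.sum_le_sum hcell
    _ = _ := by
        rw [Finset.sum_const, nsmul_eq_mul, ENNReal.ofReal_mul (by positivity),
          ENNReal.ofReal_natCast, ENNReal.ofReal_pow (by positivity)]

/-- Continuity at `u` constrains finitely many coordinates; for large `M` they are all among the
first `M`, and points sharing a cell with `u` differ there by at most `1 / M`. -/
theorem eventually_mem_innerSet {G : Set (ℕ → ℝ)} (hG : IsOpen G) {u : ℕ → ℝ}
    (hu : ∀ i, u i ∈ Set.Ioo (0 : ℝ) 1)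
    (h0 : Tendsto (fun k => ∏ j ∈ Finset.range k, u j) atTop (nhds 0))
    (huG : ranked (gem 1 u) ∈ G) : ∀ᶠ M in atTop, u ∈ innerSet G M := by
  have hnhds := (continuousWithinAt_ranked_gem_one (fun i => Set.Ioo_subset_Icc_self (hu i)) h0)
    (hG.mem_nhds huG)
  rw [mem_map, mem_nhdsWithin_iff_exists_mem_nhds_inter] at hnhds
  obtain ⟨W, hW, hWG⟩ := hnhds
  rw [nhds_pi, Filter.mem_pi'] at hW
  obtain ⟨I, t, ht, htW⟩ := hW
  have hI : ∀ᶠ M : ℕ in atTop, ∀ i ∈ I, i < M ∧ Metric.closedBall (u i) (1 / (M : ℝ)) ⊆ t i := by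
    rw [eventually_all_finset]
    intro i _
    obtain ⟨ε, hε, hball⟩ := Metric.mem_nhds_iff.1 (ht i)
    filter_upwards [eventually_gt_atTop i,
      tendsto_one_div_atTop_nhds_zero_nat.eventually_lt_const hε] with M h1 h2
    exact ⟨h1, (Metric.closedBall_subset_ball h2).trans hball⟩
  filter_upwards [hI, eventually_gt_atTop 0] with M hM hM0
  have hM0' : (0 : ℝ) < M := by exact_mod_cast hM0
  have hlt : ∀ i, ⌊u i * M⌋₊ < M := by
    intro i
    rw [Nat.floor_lt (mul_nonneg (hu i).1.le hM0'.le)]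
    nlinarith [(hu i).2]
  have hcell : ∀ i, u i ∈ Set.Ico ((⌊u i * M⌋₊ : ℝ) / M) (((⌊u i * M⌋₊ : ℝ) + 1) / M) := by
    intro i
    rw [Set.mem_Ico, div_le_iff₀ hM0', lt_div_iff₀ hM0']
    exact ⟨Nat.floor_le (mul_nonneg (hu i).1.le hM0'.le), Nat.lt_floor_add_one _⟩
  refine Set.mem_biUnion (x := fun i : Fin M => (⟨⌊u i * M⌋₊, hlt i⟩ : Fin M)) ?_
    (fun i => hcell i)
  refine Finset.mem_coe.2 (mem_innerCells.2 fun v hv hvJ => ?_)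
  refine hWG ⟨htW fun i hi => ?_, hv⟩
  obtain ⟨hiM, hball⟩ := hM i (Finset.mem_coe.1 hi)
  refine hball ?_
  have h1 := hcell i
  have h2 := hvJ ⟨i, hiM⟩
  simp only [Set.mem_Ico, add_div] at h1 h2
  rw [Metric.mem_closedBall, Real.dist_eq]
  exact abs_le.2 ⟨by linarith, by linarith⟩

/-- Almost every point of the preimage of `G` lies in all inner sets from some `K` on. These tail
intersections increase with `K`, so one of them already has measure above `c`. -/
theorem exists_lt_card_innerCells {G : Set (ℕ → ℝ)} (hG : IsOpen G) {c : ENNReal}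
    (hc : c < poissonDirichlet 1 G) :
    ∃ M : ℕ, c < ENNReal.ofReal ((innerCells G M).card * (1 / (M : ℝ)) ^ M) := by
  have hmeas : Measurable fun u => ranked (gem 1 u) := measurable_ranked.comp (measurable_gem 1)
  rw [poissonDirichlet, Measure.map_apply hmeas hG.measurableSet] at hc
  have hmono : Monotone fun K => ⋂ M ≥ K, innerSet G M := fun K K' hK =>
    Set.biInter_subset_biInter_left fun M (hM : K' ≤ M) => hK.trans hM
  have hle : (Measure.infinitePi fun _ : ℕ => uniform01) ((fun u => ranked (gem 1 u)) ⁻¹' G) ≤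
      (Measure.infinitePi fun _ : ℕ => uniform01) (⋃ K, ⋂ M ≥ K, innerSet G M) := by
    refine measure_mono_ae ?_
    filter_upwards [ae_forall_mem_Ioo, ae_frequently_le_half] with u h1 h2 huG
    obtain ⟨K, hK⟩ := eventually_atTop.1
      (eventually_mem_innerSet hG h1 (tendsto_prod_range_zero h1 h2) huG)
    exact Set.mem_iUnion.2 ⟨K, Set.mem_iInter₂.2 hK⟩
  have hc' := hc.trans_le hle
  rw [hmono.measure_iUnion, lt_iSup_iff] at hc'
  obtain ⟨K, hK⟩ := hc'
  exact ⟨K, hK.trans_le ((measure_mono (Set.biInter_subset_of_mem (le_refl K))).trans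
    (infinitePi_innerSet_le G K))⟩

/-! ### Counting integers and convergence in distribution. -/

theorem uniformOn_Icc_one_apply (n : ℕ) (p : ℕ → Prop) [DecidablePred p] :
    uniformOn (Set.Icc 1 n) {m | p m} =
      ((Finset.Icc 1 n).filter p).card / (n : ENNReal) := by
  rw [uniformOn, cond_apply measurableSet_Icc]
  have h1 : (Set.Icc 1 n : Set ℕ) = ((Finset.Icc 1 n : Finset ℕ) : Set ℕ) := by simp
  have h2 : (Set.Icc 1 n : Set ℕ) ∩ {m | p m} = (((Finset.Icc 1 n).filter p : Finset ℕ) : Set ℕ) := by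
    ext m; simp
  rw [h2, h1, Measure.count_apply_finset, Measure.count_apply_finset]
  simp [ENNReal.div_eq_inv_mul]

/-- An integer `m` with positive weight on an inner cell has an ordering of its factors whose ratios
lie in that cell, hence is counted on the right; its total weight is at most 1. -/
theorem sum_innerCells_le_card {G : Set (ℕ → ℝ)} (n M : ℕ)
    [DecidablePred fun m => logPrimeFactors n m ∈ G] :
    ∑ J ∈ innerCells G M, ∑ m ∈ Finset.Icc 1 n, pickWeight M M n m J ≤
      (((Finset.Icc 1 n).filter fun m => logPrimeFactors n m ∈ G).card : ℝ) := by
  rw [Finset.sum_comm, Finset.card_eq_sum_ones, Nat.cast_sum, Finset.sum_filter]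
  refine Finset.sum_le_sum fun m hm => ?_
  obtain ⟨h1, h2⟩ := Finset.mem_Icc.1 hm
  have hm0 : m ≠ 0 := by omega
  have hmn : (m : ℝ) ≤ n := by exact_mod_cast h2
  split_ifs with hG
  · rw [Nat.cast_one]
    exact (Finset.sum_le_univ_sum_of_nonneg fun J => pickWeight_nonneg hm0 hmn J).trans
      (sum_pickWeight_le_one hm0 hmn)
  · refine (Finset.sum_eq_zero fun J hJ => ?_).le
    by_contra hw
    obtain ⟨l, hl, hlJ⟩ := exists_perm_of_pickWeight_ne_zero hm0 hw
    refine hG ?_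
    rw [logPrimeFactors_eq_ranked_gem hm0 h2 hl]
    refine mem_innerCells.1 hJ _ (logRatios_mem_Icc (fun p hp =>
      Nat.prime_of_mem_primeFactorsList (hl.mem_iff.1 hp)) ?_) hlJ
    rwa [hl.prod_eq, Nat.prod_primeFactorsList hm0]

theorem eventually_le_uniformOn {G : Set (ℕ → ℝ)} (hG : IsOpen G) {c : ENNReal}
    (hc : c < poissonDirichlet 1 G) :
    ∀ᶠ n : ℕ in atTop, c ≤ uniformOn (Set.Icc 1 n) {m | logPrimeFactors n m ∈ G} := by
  classical
  obtain ⟨M, hM⟩ := exists_lt_card_innerCells hG hc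
  have hctop : c ≠ ⊤ := hM.ne_top
  rw [ENNReal.lt_ofReal_iff_toReal_lt hctop] at hM
  have hK : 0 < ((innerCells G M).card : ℝ) := by
    rcases Nat.eq_zero_or_pos (innerCells G M).card with h | h
    · rw [h, Nat.cast_zero, zero_mul] at hM
      exact absurd hM (not_lt.2 ENNReal.toReal_nonneg)
    · exact_mod_cast h
  -- Share `c` equally among the inner cells, so that each share is below the cell volume.
  have hd : c.toReal / (innerCells G M).card < (1 / (M : ℝ)) ^ M := by
    rwa [div_lt_iff₀ hK, mul_comm]
  have hev : ∀ᶠ n : ℕ in atTop, ∀ J ∈ innerCells G M,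
      c.toReal / (innerCells G M).card * n ≤ ∑ m ∈ Finset.Icc 1 n, pickWeight M M n m J := by
    rw [eventually_all_finset]
    intro J _
    have := tendsto_natCast_atTop_atTop.eventually (eventually_mul_le_sum_pickWeight J hd)
    simpa only [Nat.floor_natCast] using this
  filter_upwards [hev, eventually_gt_atTop 0] with n hn hn0
  have h := (Finset.sum_le_sum hn).trans (sum_innerCells_le_card n M)
  rw [Finset.sum_const, nsmul_eq_mul, ← mul_assoc, mul_div_cancel₀ _ hK.ne'] at h
  rw [uniformOn_Icc_one_apply, ENNReal.le_div_iff_mul_le (by simp [hn0.ne']) (by simp)]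
  rw [← ENNReal.ofReal_toReal hctop, ← ENNReal.ofReal_natCast, ← ENNReal.ofReal_natCast,
    ← ENNReal.ofReal_mul ENNReal.toReal_nonneg]
  exact ENNReal.ofReal_le_ofReal h

theorem theorem4p1
    {Ω : ℕ → Type*} [∀ n, MeasurableSpace (Ω n)]
    (P : (n : ℕ) → Measure (Ω n)) [∀ n, IsProbabilityMeasure (P n)]
    (N : (n : ℕ) → Ω n → ℕ)
    (hN : ∀ n : ℕ, 1 < n → HasLaw (N n) (uniformOn (Set.Icc 1 n)) (P n))
    {Ω' : Type*} [MeasurableSpace Ω'] (P' : Measure Ω') [IsProbabilityMeasure P']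
    (Z : Ω' → ℕ → ℝ) (hZ : HasLaw Z (poissonDirichlet 1) P') :
    TendstoInDistribution (fun n ω => logPrimeFactors n (N n ω)) atTop Z P P' ∧
      ∀ k : ℕ, 0 < k →
        TendstoInDistribution (fun n ω (i : Fin k) => logPrimeFactors n (N n ω) i) atTop
          (fun ω (i : Fin k) => Z ω i) P P' := by
  have hmeas : ∀ n, AEMeasurable (fun ω => logPrimeFactors n (N n ω)) (P n) := by
    intro n
    rcases lt_or_ge 1 n with hn | hn
    · exact (Measurable.of_discrete (f := logPrimeFactors n)).comp_aemeasurable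
        (hN n hn).aemeasurable
    -- No law is assumed for `N n` when `n ≤ 1`, but `log n = 0` makes every quotient 0.
    · have h0 : ∀ m, logPrimeFactors n m = 0 := by
        intro m
        funext i
        rw [logPrimeFactors_eq_getD]
        interval_cases n <;> simp
      simp only [h0]
      exact aemeasurable_const
  have hmain : TendstoInDistribution (fun n ω => logPrimeFactors n (N n ω)) atTop Z P P' := by
    refine ⟨hmeas, hZ.aemeasurable, ?_⟩
    refine tendsto_of_forall_isOpen_le_liminf' fun G hG => ?_
    refine le_of_forall_lt fun c hc => ?_
    obtain ⟨d, hcd, hd⟩ := exists_between hc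
    refine hcd.trans_le (le_liminf_of_le (by isBoundedDefault) ?_)
    have hd' : d < poissonDirichlet 1 G := by rwa [← hZ.map_eq]
    filter_upwards [eventually_le_uniformOn hG hd', eventually_gt_atTop 1] with n hn hn1
    refine hn.trans (le_of_eq ?_)
    change _ = (P n).map (logPrimeFactors n ∘ N n) G
    rw [← AEMeasurable.map_map_of_aemeasurable (Measurable.of_discrete).aemeasurable
      (hN n hn1).aemeasurable, (hN n hn1).map_eq,
      Measure.map_apply Measurable.of_discrete hG.measurableSet]
    rfl
  refine ⟨hmain, fun k _ => ?_⟩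
  exact hmain.continuous_comp (g := fun z : ℕ → ℝ => fun i : Fin k => z i) (by fun_prop)
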